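/- Let $X$ be a finite set of $n$ alternatives. A domain is a set $D$ of (strict) linear orders on $X$; the most preferred alternative of an order has rank $1$ and the last one has rank $n$. The domain $D$ is Arrow's single-peaked if in every triple of distinct alternatives there is one that no order in $D$ ranks last among the three; it is maximal if no Arrow's single-peaked domain on $X$ properly contains it. $D$ is $k$-rich if for every $1\le k'\le k$ and every alternative $a$ some order in $D$ gives $a$ rank $k'$; $D$ has richness $r$ if it is $r$-rich but not $(r+1)$-rich. An alternative is terminal in $D$ if some order in $D$ ranks it last. Let $D$ be a maximal Arrow's single-peaked domain on $X$. 1. If $D$ has richness $r$, then at least one and at most two alternatives are given only ranks in $\{1,\dots,r\}$ by the orders in $D$. 2. If $n\ge 2$, then $D$ has exactly two terminal alternatives, and an alternative is given every rank $1,\dots,n$ by orders in $D$ if and only if it is terminal in $D$. -/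

import Mathlib

/-- A preference order on `α`: a strict linear order, where `P.Prefers a b` means that `a` is
ranked above `b`. -/
@[ext]
structure PrefOrder (α : Type*) where
  Prefers : α → α → Prop
  irrefl : ∀ a, ¬ Prefers a a
  trans : ∀ a b c, Prefers a b → Prefers b c → Prefers a c
  total : ∀ a b, a ≠ b → Prefers a b ∨ Prefers b a

namespace PrefOrder

/-- The rank of `a`: one plus the number of alternatives ranked above `a`, so that the most
preferred alternative has rank `1` and the last one has rank equal to the number of
alternatives. -/
noncomputable def rank {α : Type*} (P : PrefOrder α) (a : α) : ℕ :=
  {b : α | P.Prefers b a}.ncard + 1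

/-- Within the set `S`, every other alternative is ranked above `x` by `P`. -/
def IsBottomIn {α : Type*} (P : PrefOrder α) (S : Set α) (x : α) : Prop :=
  x ∈ S ∧ ∀ y ∈ S, y ≠ x → P.Prefers y x

end PrefOrder

/-- A domain `D` is Arrow's single-peaked if every triple of distinct alternatives satisfies a
never-bottom condition: some member of the triple is never ranked last within the triple by an
order of `D`. -/
def IsArrowSinglePeaked {α : Type*} (D : Set (PrefOrder α)) : Prop :=
  ∀ a b c : α, a ≠ b → a ≠ c → b ≠ c →
    ∃ x ∈ ({a, b, c} : Set α), ∀ P ∈ D, ¬ P.IsBottomIn {a, b, c} x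

/-- A maximal Arrow's single-peaked domain: one that is not properly contained in another
Arrow's single-peaked domain on the same alternatives. -/
def IsMaximalArrowSinglePeaked {α : Type*} (D : Set (PrefOrder α)) : Prop :=
  Maximal IsArrowSinglePeaked D

/-- The range of `a` in `D`: the set of ranks given to `a` by the orders in `D`. -/
def rankRange {α : Type*} (D : Set (PrefOrder α)) (a : α) : Set ℕ :=
  {k | ∃ P ∈ D, P.rank a = k}

/-- `D` is `k`-rich if every alternative is given each of the ranks `1, …, k` by some order
in `D`. -/
def IsRich {α : Type*} (D : Set (PrefOrder α)) (k : ℕ) : Prop :=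
  ∀ k' : ℕ, 1 ≤ k' → k' ≤ k → ∀ a : α, ∃ P ∈ D, P.rank a = k'

/-- `D` has richness `k` if it is `k`-rich but not `(k + 1)`-rich. -/
def HasRichness {α : Type*} (D : Set (PrefOrder α)) (k : ℕ) : Prop :=
  IsRich D k ∧ ¬ IsRich D (k + 1)

/-- A terminal alternative of `D` is one that is ranked last by some order in `D`. -/
def IsTerminalAlternative {α : Type*} (D : Set (PrefOrder α)) (a : α) : Prop :=
  ∃ P ∈ D, P.IsBottomIn Set.univ a

/-! Maximality gives two facts. If `S` is a top segment of `Q ∈ D`, reordering `S` by any `P ∈ D`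
stays in `D` (`glue_mem`). If `S` has at least two elements, no alternative is last in `S`
throughout `D` (`exists_isBottomIn_ne`). Together they move an alternative up by one rank, so each
range is an initial segment of the ranks. Hence an alternative missing a rank up to `r + 1` never
exceeds rank `r`, and a terminal one takes all ranks. The bounds by two follow from the never-bottom
condition on a triple. -/

namespace PrefOrder

variable {α : Type*}

theorem asymm (P : PrefOrder α) {x y : α} (h : P.Prefers x y) : ¬ P.Prefers y x :=
  fun h' => P.irrefl x (P.trans x y x h h')

theorem nonempty (α : Type*) : Nonempty (PrefOrder α) := by
  classical
  let r : α → α → Prop := WellOrderingRel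
  exact ⟨⟨r, fun a => irrefl_of r a, fun a b c => trans_of r, fun a b h => by
    rcases trichotomous_of r a b with h' | h' | h'
    · exact Or.inl h'
    · exact absurd h' h
    · exact Or.inr h'⟩⟩

/-- `S` consists of the best alternatives of `P`. -/
def IsTopSegment (P : PrefOrder α) (S : Set α) : Prop :=
  ∀ x ∈ S, ∀ y ∉ S, P.Prefers x y

/-- The order obtained from `P` by moving `a` to the top. -/
def lift (P : PrefOrder α) (a : α) : PrefOrder α where
  Prefers x y := y ≠ a ∧ (x = a ∨ P.Prefers x y)
  irrefl x h := h.2.elim h.1 (P.irrefl x)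
  trans x y z h h' := ⟨h'.1, h.2.imp_right fun h₂ =>
    h'.2.elim (fun e => absurd e h.1) (P.trans x y z h₂)⟩
  total x y h := by
    have := P.total x y h
    by_cases hx : x = a
    · exact Or.inl ⟨fun e => h (hx.trans e.symm), Or.inl hx⟩
    · by_cases hy : y = a
      · exact Or.inr ⟨hx, Or.inl hy⟩
      · exact this.imp (fun h => ⟨hy, Or.inr h⟩) (fun h => ⟨hx, Or.inr h⟩)

/-- The order with `S` on top, ordered by `P`, and the other alternatives below, ordered by `Q`. -/
def glue (P : PrefOrder α) (S : Set α) (Q : PrefOrder α) : PrefOrder α where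
  Prefers x y := (x ∈ S ∧ y ∈ S ∧ P.Prefers x y) ∨ (x ∈ S ∧ y ∉ S) ∨
    (x ∉ S ∧ y ∉ S ∧ Q.Prefers x y)
  irrefl x h := by
    have := P.irrefl x
    have := Q.irrefl x
    tauto
  trans x y z h h' := by
    have := P.trans x y z
    have := Q.trans x y z
    tauto
  total x y h := by
    have := P.total x y h
    have := Q.total x y h
    tauto

theorem glue_isTopSegment (P Q : PrefOrder α) (S : Set α) : (P.glue S Q).IsTopSegment S :=
  fun _ hx _ hy => Or.inr (Or.inl ⟨hx, hy⟩)

theorem glue_prefers_of_mem {P Q : PrefOrder α} {S : Set α} {x y : α} (hx : x ∈ S) (hy : y ∈ S) :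
    (P.glue S Q).Prefers x y ↔ P.Prefers x y := by
  simp [glue, hx, hy]

theorem glue_prefers_of_notMem {P Q : PrefOrder α} {S : Set α} (hS : Q.IsTopSegment S) {x y : α}
    (h : x ∉ S ∨ y ∉ S) : (P.glue S Q).Prefers x y ↔ Q.Prefers x y := by
  have h₁ := hS x
  have h₂ := hS y
  have h₃ := @asymm α Q x y
  simp only [glue]
  grind

theorem IsBottomIn.unique {P : PrefOrder α} {S : Set α} {x y : α} (hx : P.IsBottomIn S x)
    (hy : P.IsBottomIn S y) : x = y := by
  by_contra h
  exact P.asymm (hx.2 y hy.1 (Ne.symm h)) (hy.2 x hx.1 h)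

theorem IsBottomIn.mono {P : PrefOrder α} {S T : Set α} {x : α} (hx : P.IsBottomIn S x)
    (hT : T ⊆ S) (hxT : x ∈ T) : P.IsBottomIn T x :=
  ⟨hxT, fun y hy => hx.2 y (hT hy)⟩

theorem exists_isBottomIn (P : PrefOrder α) {S : Set α} (hS : S.Finite) (hne : S.Nonempty) :
    ∃ x, P.IsBottomIn S x := by
  induction S, hS using Set.Finite.induction_on with
  | empty => simp at hne
  | @insert a S ha _ ih =>
    rcases S.eq_empty_or_nonempty with rfl | h
    · exact ⟨a, by simp, by simp⟩
    · obtain ⟨x, hx, hb⟩ := ih h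
      rcases P.total a x (by rintro rfl; exact ha hx) with h' | h'
      · refine ⟨x, Or.inr hx, ?_⟩
        rintro y (rfl | hy) hne
        exacts [h', hb y hy hne]
      · refine ⟨a, Or.inl rfl, ?_⟩
        rintro y (rfl | hy) hne
        · exact absurd rfl hne
        · by_cases e : y = x
          · exact e ▸ h'
          · exact P.trans y x a (hb y hy e) h'

theorem IsBottomIn.rank_eq_ncard [Finite α] {P : PrefOrder α} {S : Set α} {a : α}
    (h : P.IsBottomIn S a) (hS : P.IsTopSegment S) : P.rank a = S.ncard := by
  have : {b | P.Prefers b a} = S \ {a} := by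
    ext b
    have h₁ := hS a h.1 b
    have h₂ := h.2 b
    have h₃ := @asymm α P a b
    have h₄ := P.irrefl a
    simp only [Set.mem_ofPred_eq, Set.mem_sdiff, Set.mem_singleton_iff]
    grind
  rw [rank, this, Set.ncard_sdiff_singleton_add_one h.1 (Set.toFinite _)]

/-- The alternatives ranked at least as high as `a`. -/
def upTo (P : PrefOrder α) (a : α) : Set α := {x | x = a ∨ P.Prefers x a}

theorem isBottomIn_upTo (P : PrefOrder α) (a : α) : P.IsBottomIn (P.upTo a) a :=
  ⟨Or.inl rfl, fun _ hy hne => hy.resolve_left hne⟩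

theorem isTopSegment_upTo (P : PrefOrder α) (a : α) : P.IsTopSegment (P.upTo a) := by
  intro x hx y hy
  have hya : P.Prefers a y := (P.total a y fun e => hy (Or.inl e.symm)).resolve_right
    fun h => hy (Or.inr h)
  rcases hx with rfl | hx
  exacts [hya, P.trans x a y hx hya]

theorem rank_lt_rank [Finite α] {P : PrefOrder α} {x y : α} (h : P.Prefers x y) :
    P.rank x < P.rank y := by
  refine Nat.succ_lt_succ (Set.ncard_lt_ncard ⟨fun z hz => P.trans z x y hz h, fun h' => ?_⟩)
  exact P.irrefl x (h' h)

theorem rank_mem_Icc [Fintype α] (P : PrefOrder α) (a : α) :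
    P.rank a ∈ Set.Icc 1 (Fintype.card α) := by
  refine ⟨Nat.le_add_left _ _, ?_⟩
  rw [(P.isBottomIn_upTo a).rank_eq_ncard (P.isTopSegment_upTo a), ← Nat.card_eq_fintype_card]
  exact Set.ncard_le_card _

theorem rank_eq_card_iff [Fintype α] {P : PrefOrder α} {a : α} :
    P.rank a = Fintype.card α ↔ P.IsBottomIn Set.univ a := by
  refine ⟨fun h => ⟨Set.mem_univ a, fun y _ hy => ?_⟩, fun h => ?_⟩
  · by_contra h'
    have h₁ := rank_lt_rank ((P.total y a hy).resolve_left h')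
    have h₂ := (P.rank_mem_Icc y).2
    lia
  · rw [h.rank_eq_ncard fun x _ y hy => absurd (Set.mem_univ y) hy, Set.ncard_univ,
      Nat.card_eq_fintype_card]

end PrefOrder

open PrefOrder

/-! ### Consequences of maximality -/

namespace IsMaximalArrowSinglePeaked

variable {α : Type*} {D : Set (PrefOrder α)}

theorem mem_of_forall (hD : IsMaximalArrowSinglePeaked D) {R : PrefOrder α}
    (h : ∀ a b c : α, a ≠ b → a ≠ c → b ≠ c → ∃ x ∈ ({a, b, c} : Set α),
      (∀ P ∈ D, ¬ P.IsBottomIn {a, b, c} x) ∧ ¬ R.IsBottomIn {a, b, c} x) : R ∈ D := by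
  refine hD.2 (y := insert R D) (fun a b c hab hac hbc => ?_) (Set.subset_insert R D)
    (Set.mem_insert R D)
  obtain ⟨x, hx, h₁, h₂⟩ := h a b c hab hac hbc
  refine ⟨x, hx, ?_⟩
  rintro P (rfl | hP)
  exacts [h₂, h₁ P hP]

/-- A single order is always Arrow's single-peaked, having only one bottom in each triple. -/
theorem nonempty (hD : IsMaximalArrowSinglePeaked D) : D.Nonempty := by
  obtain ⟨P⟩ := PrefOrder.nonempty α
  by_contra h
  rw [Set.not_nonempty_iff_eq_empty] at h
  refine h.subset (hD.mem_of_forall (R := P) fun a b c hab hac hbc => ?_)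
  by_cases ha : P.IsBottomIn {a, b, c} a
  · exact ⟨b, by simp, by simp [h], fun hb => hab (ha.unique hb)⟩
  · exact ⟨a, by simp, by simp [h], ha⟩

/-- The bottom of a triple in the glued order is its bottom in `P` if the triple lies in `S`, and in
`Q` otherwise. -/
theorem glue_mem (hD : IsMaximalArrowSinglePeaked D) {P Q : PrefOrder α} (hP : P ∈ D)
    (hQ : Q ∈ D) {S : Set α} (hS : Q.IsTopSegment S) : P.glue S Q ∈ D := by
  refine hD.mem_of_forall fun a b c hab hac hbc => ?_
  obtain ⟨x, hx, h⟩ := hD.1 a b c hab hac hbc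
  refine ⟨x, hx, h, fun hb => ?_⟩
  by_cases hT : ({a, b, c} : Set α) ⊆ S
  · exact h P hP ⟨hx, fun y hy hne => (glue_prefers_of_mem (hT hy) (hT hx)).1 (hb.2 y hy hne)⟩
  · obtain ⟨z, hz, hzS⟩ := Set.not_subset.1 hT
    have hxS : x ∉ S := fun hxS =>
      (P.glue S Q).asymm (glue_isTopSegment P Q S x hxS z hzS)
        (hb.2 z hz fun e => hzS (e ▸ hxS))
    exact h Q hQ ⟨hx, fun y hy hne =>
      (glue_prefers_of_notMem hS (Or.inr hxS)).1 (hb.2 y hy hne)⟩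

/-- If `a` were last in `S` throughout `D`, maximality would force `P.lift a` into `D`, although it
ranks `a` first. -/
theorem exists_isBottomIn_ne [Finite α] (hD : IsMaximalArrowSinglePeaked D) {P : PrefOrder α}
    (hP : P ∈ D) {S : Set α} (hS : P.IsTopSegment S) {a : α} (ha : a ∈ S) (hnt : S.Nontrivial) :
    ∃ Q ∈ D, ∃ b, b ≠ a ∧ Q.IsBottomIn S b := by
  by_contra! hcon
  have hbot : ∀ Q ∈ D, Q.IsBottomIn S a := fun Q hQ => by
    obtain ⟨b, hb⟩ := Q.exists_isBottomIn (Set.toFinite S) hnt.nonempty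
    by_cases e : b = a
    · exact e ▸ hb
    · exact absurd hb (hcon Q hQ b e)
  obtain ⟨c, hc, hca⟩ := hnt.exists_ne a
  have hmem : P.lift a ∈ D := by
    refine hD.mem_of_forall fun u v w huv huw hvw => ?_
    -- In such a triple `D` always has `a` last, so either other member is never bottom; the one `P`
    -- prefers also works for the lift. Any other triple has the same bottom in `P` and in the lift.
    by_cases hT : a ∈ ({u, v, w} : Set α) ∧ ({u, v, w} : Set α) ⊆ S
    · obtain ⟨haT, hTS⟩ := hT
      have hx : ∃ x ∈ ({u, v, w} : Set α), x ≠ a ∧ ∃ y ∈ ({u, v, w} : Set α), y ≠ a ∧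
          P.Prefers x y := by
        have h₁ := P.total u v huv
        have h₂ := P.total u w huw
        have h₃ := P.total v w hvw
        simp only [Set.mem_insert_iff, Set.mem_singleton_iff] at haT ⊢
        grind
      obtain ⟨x, hx, hxa, y, hy, hya, hxy⟩ := hx
      refine ⟨x, hx, fun Q hQ hb => ?_, fun hb => ?_⟩
      · exact Q.asymm (hb.2 a haT hxa.symm) ((hbot Q hQ).2 x (hTS hx) hxa)
      · have hne : y ≠ x := by rintro rfl; exact P.irrefl y hxy
        exact P.asymm hxy ((hb.2 y hy hne).2.resolve_left hya)
    · obtain ⟨x, hx, h⟩ := hD.1 u v w huv huw hvw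
      refine ⟨x, hx, h, fun hb => h P hP ⟨hx, fun y hy hne => ?_⟩⟩
      rcases (hb.2 y hy hne).2 with rfl | h'
      · obtain ⟨z, hz, hzS⟩ := Set.not_subset.1 fun hTS => hT ⟨hy, hTS⟩
        refine hS y ha x fun hxS => ?_
        have hzx : z ≠ x := fun e => hzS (e ▸ hxS)
        have hzy : z ≠ y := fun e => hzS (e ▸ ha)
        exact P.asymm (hS x hxS z hzS) ((hb.2 z hz hzx).2.resolve_left hzy)
      · exact h'
  exact ((hbot _ hmem).2 c hc hca).1 rfl

theorem mem_rankRange_of_succ_mem [Finite α] (hD : IsMaximalArrowSinglePeaked D) {a : α} {k : ℕ}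
    (hk : 1 ≤ k) (h : k + 1 ∈ rankRange D a) : k ∈ rankRange D a := by
  obtain ⟨P, hP, hr⟩ := h
  have ha := P.isBottomIn_upTo a
  have hS := P.isTopSegment_upTo a
  set S := P.upTo a
  have hcard : S.ncard = k + 1 := by rw [← ha.rank_eq_ncard hS, hr]
  obtain ⟨Q, hQ, b, hba, hb⟩ := hD.exists_isBottomIn_ne hP hS ha.1
    ((Set.one_lt_ncard_iff_nontrivial).1 (by lia))
  -- Gluing `Q` onto `S` puts `b` at rank `k + 1`; restoring the order of `P` on the rest of `S`
  -- leaves `a` at rank `k`.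
  have hS' : (Q.glue S P).IsTopSegment (S \ {b}) := by
    rintro x ⟨hx, hxb⟩ y hy
    by_cases hyS : y ∈ S
    · obtain rfl : y = b := by_contra fun e => hy ⟨hyS, e⟩
      exact (glue_prefers_of_mem hx hyS).2 (hb.2 x hx hxb)
    · exact glue_isTopSegment Q P S x hx y hyS
  refine ⟨P.glue (S \ {b}) (Q.glue S P), hD.glue_mem hP (hD.glue_mem hQ hP hS) hS', ?_⟩
  have haS : a ∈ S \ {b} := ⟨ha.1, hba.symm⟩
  have hbot : (P.glue (S \ {b}) (Q.glue S P)).IsBottomIn (S \ {b}) a :=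
    ⟨haS, fun y hy hne => (glue_prefers_of_mem hy haS).2 (ha.2 y hy.1 hne)⟩
  rw [hbot.rank_eq_ncard (glue_isTopSegment _ _ _), Set.ncard_sdiff_singleton_of_mem hb.1, hcard]
  rfl

theorem mem_rankRange_of_le [Finite α] (hD : IsMaximalArrowSinglePeaked D) {a : α} {j k : ℕ}
    (hj : 1 ≤ j) (hjk : j ≤ k) (h : k ∈ rankRange D a) : j ∈ rankRange D a := by
  induction k, hjk using Nat.le_induction with
  | base => exact h
  | succ k hjk ih => exact ih (hD.mem_rankRange_of_succ_mem (hj.trans hjk) h)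

theorem nonempty_rankRange_subset [Finite α] (hD : IsMaximalArrowSinglePeaked D) {r : ℕ}
    (hr : HasRichness D r) : {a : α | rankRange D a ⊆ Set.Icc 1 r}.Nonempty := by
  obtain ⟨h₁, h₂⟩ := hr
  simp only [IsRich, not_forall] at h₂
  obtain ⟨k, hk, hkr, a, ha⟩ := h₂
  refine ⟨a, fun m hm => ⟨?_, ?_⟩⟩
  · obtain ⟨P, -, rfl⟩ := hm
    exact Nat.le_add_left _ _
  · by_contra hmr
    exact ha (hD.mem_rankRange_of_le hk (by lia) hm)

/-- An order giving rank `r` to the never-bottom member would rank the other two above it. -/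
theorem not_three_rankRange_subset [Finite α] (hD : IsMaximalArrowSinglePeaked D) {r : ℕ}
    (hr : IsRich D r) {a b c : α} (hab : a ≠ b) (hac : a ≠ c) (hbc : b ≠ c)
    (h : ∀ x ∈ ({a, b, c} : Set α), rankRange D x ⊆ Set.Icc 1 r) : False := by
  obtain ⟨x, hx, hb⟩ := hD.1 a b c hab hac hbc
  -- Richness says nothing when `r = 0`; that case is excluded by the rank of `x` in some order of
  -- `D`.
  have hr1 : 1 ≤ r := by
    obtain ⟨P, hP⟩ := hD.nonempty
    have := h x hx ⟨P, hP, rfl⟩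
    exact this.1.trans this.2
  obtain ⟨P, hP, hPx⟩ := hr r hr1 le_rfl x
  refine hb P hP ⟨hx, fun y hy hne => by_contra fun hyx => ?_⟩
  have h₁ := rank_lt_rank ((P.total y x hne).resolve_left hyx)
  have h₂ := (h y hy ⟨P, hP, rfl⟩).2
  lia

theorem ncard_isTerminalAlternative [Fintype α] (hD : IsMaximalArrowSinglePeaked D)
    (hn : 2 ≤ Fintype.card α) : {a : α | IsTerminalAlternative D a}.ncard = 2 := by
  have hnt : Nontrivial α := Fintype.one_lt_card_iff_nontrivial.1 hn
  obtain ⟨P, hP⟩ := hD.nonempty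
  obtain ⟨a, ha⟩ := P.exists_isBottomIn (Set.toFinite Set.univ) Set.univ_nonempty
  -- The whole set is a top segment, which yields a second terminal alternative.
  obtain ⟨Q, hQ, b, hba, hb⟩ := hD.exists_isBottomIn_ne hP
    (fun x _ y hy => absurd (Set.mem_univ y) hy) ha.1 Set.nontrivial_univ
  refine Set.ncard_eq_two.2 ⟨a, b, hba.symm, Set.Subset.antisymm ?_ ?_⟩
  · rintro c ⟨R, hR, hc⟩
    by_contra hne
    simp only [Set.mem_insert_iff, Set.mem_singleton_iff, not_or] at hne
    obtain ⟨x, hx, h⟩ := hD.1 a b c hba.symm (Ne.symm hne.1) (Ne.symm hne.2)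
    rcases hx with rfl | rfl | rfl
    · exact h P hP (ha.mono (Set.subset_univ _) (by simp))
    · exact h Q hQ (hb.mono (Set.subset_univ _) (by simp))
    · exact h R hR (hc.mono (Set.subset_univ _) (by simp))
  · rintro c (rfl | rfl)
    exacts [⟨P, hP, ha⟩, ⟨Q, hQ, hb⟩]

theorem rankRange_eq_Icc_iff [Fintype α] (hD : IsMaximalArrowSinglePeaked D) (a : α) :
    rankRange D a = Set.Icc 1 (Fintype.card α) ↔ IsTerminalAlternative D a := by
  have hn : 1 ≤ Fintype.card α := Fintype.card_pos_iff.2 ⟨a⟩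
  constructor
  · intro h
    obtain ⟨P, hP, hr⟩ := h.ge (Set.right_mem_Icc.2 hn)
    exact ⟨P, hP, rank_eq_card_iff.1 hr⟩
  · rintro ⟨P, hP, hb⟩
    refine Set.Subset.antisymm ?_ fun k hk =>
      hD.mem_rankRange_of_le hk.1 hk.2 ⟨P, hP, rank_eq_card_iff.2 hb⟩
    rintro k ⟨Q, -, rfl⟩
    exact Q.rank_mem_Icc a

end IsMaximalArrowSinglePeaked

theorem mainTheorem11 {α : Type*} [Fintype α] (D : Set (PrefOrder α))
    (hD : IsMaximalArrowSinglePeaked D) :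
    (∀ r : ℕ, HasRichness D r →
      1 ≤ {a : α | rankRange D a ⊆ Set.Icc 1 r}.ncard ∧
        {a : α | rankRange D a ⊆ Set.Icc 1 r}.ncard ≤ 2) ∧
    (2 ≤ Fintype.card α →
      {a : α | IsTerminalAlternative D a}.ncard = 2 ∧
        ∀ a : α, rankRange D a = Set.Icc 1 (Fintype.card α) ↔ IsTerminalAlternative D a) := by
  refine ⟨fun r hr => ⟨?_, ?_⟩, fun hn => ⟨hD.ncard_isTerminalAlternative hn,
    hD.rankRange_eq_Icc_iff⟩⟩
  · exact (Set.ncard_pos (Set.toFinite _)).2 (hD.nonempty_rankRange_subset hr)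
  · by_contra! h
    obtain ⟨a, b, c, ha, hb, hc, hab, hac, hbc⟩ := (Set.two_lt_ncard_iff (Set.toFinite _)).1 h
    refine hD.not_three_rankRange_subset hr.1 hab hac hbc ?_
    rintro x (rfl | rfl | rfl)
    exacts [ha, hb, hc]
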